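/- All graphs are finite and simple. For a positive integer $h$, let $[h,2,1]$ be the class of graphs $G$ for which there are a finite tree $T$ of maximum degree at most $h$ and a family $(P_v)_{v\in V(G)}$ of (non-empty, possibly one-vertex) subpaths of $T$ such that distinct vertices $u,v$ of $G$ are adjacent if and only if $P_u$ and $P_v$ have at least one vertex in common. A graph $G$ is a minimal non $[h,2,1]$ graph if $G\notin[h,2,1]$ and $G-v\in[h,2,1]$ for every $v\in V(G)$. A graph $H$ is $k$-critical if its chromatic number is $\chi(H)=k$, $\chi(H-v)<\chi(H)$ for every vertex $v$ of $H$, and $\chi(H-e)<\chi(H)$ for every edge $e$ of $H$. For a graph $H$, let $G_H$ be the graph whose vertices are: every vertex $v$ of $H$; a vertex $x_e$ for every edge $e$ of $H$; and a vertex $\tilde v$ for every vertex $v$ of $H$ with $d_H(v)=1$. Two distinct vertices of $G_H$ are adjacent if and only if they lie together in the set $$K_H=\{x_e : e\in E(H)\}\cup\{\tilde v : d_H(v)=1\}$$ or in one of the sets $$C_v=\{v\}\cup\{x_e : e\in E(H),\ v\in e\}\cup\{\tilde v \text{ if } d_H(v)=1\},\qquad v\in V(H).$$ **Theorem.** Let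 $h\ge 3$ and let $H$ be a finite simple graph. Then $G_H$ is a minimal non $[h,2,1]$ graph if and only if $H$ is $(h+1)$-critical. -/

import Mathlib

namespace PathGraphs

/-- `P` is the vertex set of a (non-empty, possibly one-vertex) path of the graph `T`. -/
def IsSubpath {W : Type*} (T : SimpleGraph W) (P : Set W) : Prop :=
  ∃ (a b : W) (p : T.Walk a b), p.IsPath ∧ P = {x | x ∈ p.support}

/-- `(P, T)` is a VPT representation of `G`: `T` is a tree, every `P v` is a subpath of `T`, and
distinct vertices of `G` are adjacent exactly when their paths share at least one vertex. -/
structure IsVPTRepresentation {V W : Type*} (G : SimpleGraph V) (T : SimpleGraph W)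
    (P : V → Set W) : Prop where
  isTree : T.IsTree
  isSubpath : ∀ v, IsSubpath T (P v)
  adj_iff : ∀ u v, u ≠ v → (G.Adj u v ↔ (P u ∩ P v).Nonempty)

open scoped Classical in
/-- Membership in the class `[h,2,1]`: `G` has a VPT representation whose (finite) host tree has
maximum degree at most `h`. -/
def InClass {V : Type*} (h : ℕ) (G : SimpleGraph V) : Prop :=
  ∃ (m : ℕ) (T : SimpleGraph (Fin m)) (P : V → Set (Fin m)),
    IsVPTRepresentation G T P ∧ T.maxDegree ≤ h

/-- The graph `G - v`. -/
abbrev deleteVertex {V : Type*} (G : SimpleGraph V) (v : V) :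
    SimpleGraph ({v}ᶜ : Set V) :=
  G.induce {v}ᶜ

/-- `G` is a minimal non `[h,2,1]` graph. -/
def IsMinimalNon {V : Type*} (h : ℕ) (G : SimpleGraph V) : Prop :=
  ¬ InClass h G ∧ ∀ v : V, InClass h (deleteVertex G v)

/-- `G` has chromatic number `k` and every vertex is a critical element. -/
def IsVertexCritical {V : Type*} (k : ℕ) (G : SimpleGraph V) : Prop :=
  G.chromaticNumber = k ∧ ∀ v : V, (deleteVertex G v).chromaticNumber < G.chromaticNumber

/-- `G` has chromatic number `k` and every edge is a critical element. -/
def IsEdgeCritical {V : Type*} (k : ℕ) (G : SimpleGraph V) : Prop :=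
  G.chromaticNumber = k ∧
    ∀ e ∈ G.edgeSet, (G.deleteEdges {e}).chromaticNumber < G.chromaticNumber

/-- `G` is `k`-critical: both `k`-vertex critical and `k`-edge critical. -/
def IsCritical {V : Type*} (k : ℕ) (G : SimpleGraph V) : Prop :=
  IsVertexCritical k G ∧ IsEdgeCritical k G

open scoped Classical in
/-- The vertices of `G_H`: one for each vertex of `H`, one for each edge of `H`, and one further
vertex (a pendant) for each vertex of `H` of degree one. -/
inductive GHVertex {V : Type*} [Fintype V] (H : SimpleGraph V) : Type _
  | vert (v : V) : GHVertex H
  | edge (e : Sym2 V) (he : e ∈ H.edgeSet) : GHVertex H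
  | pend (v : V) (hv : H.degree v = 1) : GHVertex H

/-- The central clique `K_H`: all edge vertices and all pendant vertices. -/
def centralClique {V : Type*} [Fintype V] (H : SimpleGraph V) : Set (GHVertex H) :=
  {x | (∃ e he, x = GHVertex.edge e he) ∨ (∃ v hv, x = GHVertex.pend v hv)}

/-- The clique `C_v`: the vertex `v`, the edges of `H` at `v`, and, if `v` has degree one, the
pendant vertex of `v`. -/
def vertexClique {V : Type*} [Fintype V] (H : SimpleGraph V) (v : V) : Set (GHVertex H) :=
  {x | x = GHVertex.vert v ∨ (∃ e he, v ∈ e ∧ x = GHVertex.edge e he) ∨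
    (∃ hv, x = GHVertex.pend v hv)}

/-- The graph `G_H`: distinct vertices are adjacent when they lie together in the central clique
or in one of the cliques `C_v`. -/
def graphGH {V : Type*} [Fintype V] (H : SimpleGraph V) : SimpleGraph (GHVertex H) where
  Adj x y := x ≠ y ∧ ((x ∈ centralClique H ∧ y ∈ centralClique H) ∨
    ∃ v, x ∈ vertexClique H v ∧ y ∈ vertexClique H v)
  symm := ⟨fun _ _ h => ⟨h.1.symm, h.2.imp And.symm (fun ⟨v, hv⟩ => ⟨v, hv.symm⟩)⟩⟩
  loopless := ⟨fun _ h => h.1 rfl⟩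

end PathGraphs

/-! The core fact is that `G_H` lies in [h,2,1] exactly when H is h-colorable. In a representation,
the Helly property puts all paths of the central clique through one tree vertex q, and the paths of
v and of its central neighbours through a vertex z_v. Color v by the branch at q containing z_v;
there are at most h branches. If uw is an edge and z_u, z_w share a branch, then q does not separate
them, yet all three lie on the path of x_uw, so z_u, say, lies between q and z_w. Every central
neighbour of w then has a path through z_u, although some central neighbour of w is not adjacent to
u (`InClass.colorable`). Conversely, a coloring hangs a leaf for each v on the caterpillar of its
color, and x_uw runs from leaf to leaf through the root (`InClass.of_legs`).

Both arguments adapt to deletions, matching G_H - v with H - v and G_H - x_e with H - e. Only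
recovering a coloring of H - e needs more: degrees at least 3, so that distinguishing edges remain.
Colorability of every H - v, when H itself is not h-colorable, forces minimum degree at least h,
which also rules out pendants. -/

namespace SimpleGraph

/-! ### Betweenness, medians and the Helly property in trees. -/

variable {W : Type*} {T : SimpleGraph W}

/-- `x` separates `a` from `b`: every walk from `a` to `b` visits `x`. -/
def Btw (T : SimpleGraph W) (a x b : W) : Prop :=
  ∀ p : T.Walk a b, x ∈ p.support

theorem Btw.symm {a x b : W} (hx : T.Btw a x b) : T.Btw b x a := fun p => by
  simpa using hx p.reverse

theorem IsTree.btw_of_mem_support (hT : T.IsTree) {a x b : W} {p : T.Walk a b} (hp : p.IsPath)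
    (hx : x ∈ p.support) : T.Btw a x b := by
  classical
  intro w
  have h : w.bypass = p := (hT.existsUnique_path a b).unique w.bypass_isPath hp
  exact w.support_bypass_subset_support (h ▸ hx)

theorem Walk.IsPath.append_of_disjoint {a b c : W} {p : T.Walk a b} {q : T.Walk b c}
    (hp : p.IsPath) (hq : q.IsPath) (hd : ∀ x ∈ p.support, x ∈ q.support → x = b) :
    (p.append q).IsPath := by
  rw [Walk.isPath_def, Walk.support_append]
  have hqn := hq.support_nodup
  rw [← Walk.cons_tail_support, List.nodup_cons] at hqn
  refine List.Nodup.append hp.support_nodup hqn.2 ?_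
  intro x hx hx'
  have := hd x hx (List.mem_of_mem_tail hx')
  subst this
  exact hqn.1 hx'

theorem exists_walk_of_mem_support {a b x y : W} (p : T.Walk a b) (hx : x ∈ p.support)
    (hy : y ∈ p.support) : ∃ w : T.Walk x y, w.support ⊆ p.support := by
  classical
  exact ⟨(p.takeUntil x hx).reverse.append (p.takeUntil y hy), fun z hz => by
    rw [Walk.mem_support_append_iff] at hz
    rcases hz with hz | hz
    · exact p.support_takeUntil_subset_support hx (by simpa using hz)
    · exact p.support_takeUntil_subset_support hy hz⟩

/-- Along a path, a vertex separates every earlier vertex from every later one. -/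
theorem IsTree.btw_of_mem_takeUntil_of_mem_dropUntil [DecidableEq W] (hT : T.IsTree) {a b x u v : W}
    {p : T.Walk a b} (hp : p.IsPath) (hx : x ∈ p.support) (hu : u ∈ (p.takeUntil x hx).support)
    (hv : v ∈ (p.dropUntil x hx).support) : T.Btw u x v := by
  set p₁ := p.takeUntil x hx
  set p₂ := p.dropUntil x hx
  have h : (p₁.append p₂).IsPath := by rwa [Walk.take_spec]
  rw [← p₁.take_spec hu, ← p₂.take_spec hv, ← Walk.append_assoc] at h
  have h' := h.of_append_right
  rw [Walk.append_assoc] at h'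
  exact hT.btw_of_mem_support h'.of_append_left (by simp)

/-- Of three vertices on a path of a tree, one separates the other two. -/
theorem IsTree.btw_trichotomy (hT : T.IsTree) {a b x y z : W} {p : T.Walk a b} (hp : p.IsPath)
    (hx : x ∈ p.support) (hy : y ∈ p.support) (hz : z ∈ p.support) :
    T.Btw x y z ∨ T.Btw y x z ∨ T.Btw x z y := by
  classical
  have hx' := hx
  have hz' := hz
  rw [← p.take_spec hy, Walk.mem_support_append_iff] at hx' hz'
  rcases hx' with hx₁ | hx₁ <;> rcases hz' with hz₁ | hz₁
  · have hp₁ := hp.takeUntil hy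
    have hz₂ := hz₁
    rw [← Walk.take_spec _ hx₁, Walk.mem_support_append_iff] at hz₂
    rcases hz₂ with hz₂ | hz₂
    · exact .inr (.inl (hT.btw_of_mem_takeUntil_of_mem_dropUntil hp₁ hx₁ hz₂
        (Walk.end_mem_support _)).symm)
    · exact .inr (.inr (hT.btw_of_mem_takeUntil_of_mem_dropUntil (hp₁.dropUntil hx₁) hz₂
        (Walk.start_mem_support _) (Walk.end_mem_support _)))
  · exact .inl (hT.btw_of_mem_takeUntil_of_mem_dropUntil hp hy hx₁ hz₁)
  · exact .inl (hT.btw_of_mem_takeUntil_of_mem_dropUntil hp hy hz₁ hx₁).symm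
  · have hp₁ := hp.dropUntil hy
    have hz₂ := hz₁
    rw [← Walk.take_spec _ hx₁, Walk.mem_support_append_iff] at hz₂
    rcases hz₂ with hz₂ | hz₂
    · exact .inr (.inr (hT.btw_of_mem_takeUntil_of_mem_dropUntil (hp₁.takeUntil hx₁) hz₂
        (Walk.start_mem_support _) (Walk.end_mem_support _)).symm)
    · exact .inr (.inl (hT.btw_of_mem_takeUntil_of_mem_dropUntil hp₁ hx₁
        (Walk.start_mem_support _) hz₂))

/-- Any three vertices of a tree have a median. -/
theorem IsTree.exists_median (hT : T.IsTree) (a b c : W) :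
    ∃ m, T.Btw a m b ∧ T.Btw b m c ∧ T.Btw a m c := by
  classical
  obtain ⟨p, hp, -⟩ := hT.existsUnique_path a b
  -- The median is the vertex of the path from a to b nearest to c.
  obtain ⟨m, hm, hmin⟩ := Finset.exists_min_image p.support.toFinset (T.dist c)
    ⟨a, by simp⟩
  rw [List.mem_toFinset] at hm
  obtain ⟨s, hs, hlen⟩ := hT.connected.exists_path_of_dist c m
  have key : ∀ x ∈ s.support, x ∈ p.support → x = m := by
    intro x hx hxp
    by_contra hne
    have h₁ : T.dist c x ≤ (s.takeUntil x hx).length := dist_le _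
    have h₂ := s.length_takeUntil_lt_length hx hne
    have h₃ := hmin x (by simpa using hxp)
    omega
  refine ⟨m, hT.btw_of_mem_support hp hm, ?_, ?_⟩
  · have h := hs.append_of_disjoint (hp.dropUntil hm) fun x hx hx' =>
      key x hx (p.support_dropUntil_subset_support hm hx')
    exact (hT.btw_of_mem_support h (by simp)).symm
  · have h := hs.append_of_disjoint (hp.takeUntil hm).reverse fun x hx hx' =>
      key x hx (p.support_takeUntil_subset_support hm (by simpa using hx'))
    exact (hT.btw_of_mem_support h (by simp)).symm

/-- A set of vertices that contains every vertex separating two of its members. -/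
def IsBtwConvex (T : SimpleGraph W) (S : Set W) : Prop :=
  ∀ ⦃x y z⦄, x ∈ S → y ∈ S → T.Btw x z y → z ∈ S

theorem IsBtwConvex.inter {A B : Set W} (hA : T.IsBtwConvex A) (hB : T.IsBtwConvex B) :
    T.IsBtwConvex (A ∩ B) :=
  fun _ _ _ hx hy hz => ⟨hA hx.1 hy.1 hz, hB hx.2 hy.2 hz⟩

/-- The Helly property of convex subsets of a tree. -/
theorem IsTree.helly {ι : Type*} (hT : T.IsTree) (s : Finset ι) (A : ι → Set W)
    (hA : ∀ i ∈ s, T.IsBtwConvex (A i)) (hAA : ∀ i ∈ s, ∀ j ∈ s, (A i ∩ A j).Nonempty) :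
    ∃ q, ∀ i ∈ s, q ∈ A i := by
  classical
  induction s using Finset.induction_on generalizing A with
  | empty => exact ⟨hT.connected.nonempty.some, by simp⟩
  | insert a s _ ih =>
    rcases s.eq_empty_or_nonempty with rfl | ⟨i₀, hi₀⟩
    · obtain ⟨q, hq, -⟩ := hAA a (by simp) a (by simp)
      exact ⟨q, by simpa using hq⟩
    have ha := Finset.mem_insert_self a s
    have hs : ∀ i ∈ s, i ∈ insert a s := fun i => Finset.mem_insert_of_mem
    -- Induct on the traces in A a. They meet pairwise: the median of points of the three pairwise
    -- intersections lies in all three sets.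
    obtain ⟨q, hq⟩ := ih (fun i => A i ∩ A a)
      (fun i hi => (hA i (hs i hi)).inter (hA a ha)) (fun i hi j hj => by
        obtain ⟨x, hxi, hxj⟩ := hAA i (hs i hi) j (hs j hj)
        obtain ⟨y, hyi, hya⟩ := hAA i (hs i hi) a ha
        obtain ⟨z, hzj, hza⟩ := hAA j (hs j hj) a ha
        obtain ⟨m, h₁, h₂, h₃⟩ := hT.exists_median x y z
        have hma := hA a ha hya hza h₂
        exact ⟨m, ⟨hA i (hs i hi) hxi hyi h₁, hma⟩, hA j (hs j hj) hxj hzj h₃, hma⟩)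
    refine ⟨q, fun i hi => ?_⟩
    rcases Finset.mem_insert.1 hi with rfl | hi
    · exact (hq i₀ hi₀).2
    · exact (hq i hi).1

end SimpleGraph

/-! ### From representations to colorings. -/

namespace PathGraphs

open SimpleGraph

theorem IsSubpath.isBtwConvex {W : Type*} {T : SimpleGraph W} {P : Set W} (hP : IsSubpath T P) :
    T.IsBtwConvex P := by
  obtain ⟨a, b, p, -, rfl⟩ := hP
  intro x y z hx hy hz
  obtain ⟨w, hw⟩ := exists_walk_of_mem_support p hx hy
  exact hw (hz w)

theorem IsSubpath.nonempty {W : Type*} {T : SimpleGraph W} {P : Set W} (hP : IsSubpath T P) :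
    P.Nonempty := by
  obtain ⟨a, b, p, -, rfl⟩ := hP
  exact ⟨a, p.start_mem_support⟩

/-- The paths representing a clique have a common vertex. -/
theorem IsVPTRepresentation.exists_mem_of_isClique {V W : Type*} [Finite W] {G : SimpleGraph V}
    {T : SimpleGraph W} {P : V → Set W} (hP : IsVPTRepresentation G T P) {K : Set V}
    (hK : G.IsClique K) : ∃ q, ∀ x ∈ K, q ∈ P x := by
  classical
  -- The family is indexed by the paths themselves: V may be infinite, but the tree has finitely
  -- many vertex sets.
  obtain ⟨q, hq⟩ := hP.isTree.helly (Set.toFinite (P '' K)).toFinset id (by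
    intro S hS
    simp only [Set.Finite.mem_toFinset, Set.mem_image] at hS
    obtain ⟨x, -, rfl⟩ := hS
    exact (hP.isSubpath x).isBtwConvex) (by
    intro S hS S' hS'
    simp only [Set.Finite.mem_toFinset, Set.mem_image] at hS hS'
    obtain ⟨x, hx, rfl⟩ := hS
    obtain ⟨y, hy, rfl⟩ := hS'
    by_cases hxy : x = y
    · subst hxy
      simpa using (hP.isSubpath x).nonempty
    · exact (hP.adj_iff x y hxy).1 (hK hx hy hxy))
  exact ⟨q, fun x hx => hq (P x) (by simpa using ⟨x, hx, rfl⟩)⟩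

/-- Numbers the branches at q by colors; values off the neighbourhood are irrelevant. -/
theorem exists_injOn_neighborSet {W : Type*} [Fintype W] (T : SimpleGraph W) [DecidableRel T.Adj]
    (q : W) {h : ℕ} (hh : 0 < h) (hT : T.maxDegree ≤ h) :
    ∃ f : W → Fin h, Set.InjOn f (T.neighborSet q) := by
  classical
  obtain ⟨g⟩ : Nonempty (T.neighborSet q ↪ Fin h) := by
    apply Function.Embedding.nonempty_of_card_le
    rw [Fintype.card_fin, T.card_neighborSet_eq_degree]
    exact (T.degree_le_maxDegree q).trans hT
  refine ⟨fun y => if hy : y ∈ T.neighborSet q then g ⟨y, hy⟩ else ⟨0, hh⟩, fun y hy z hz hyz => ?_⟩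
  simpa [hy, hz] using! hyz

/-- Let `K` be a clique of a graph of the class `[h,2,1]`, and let `H` be a graph whose vertices
are placed in `G` in such a way that any two adjacent ones have a common neighbour in `K` and
are distinguished, in both directions, by neighbours in `K`. Then `H` is `h`-colorable. -/
theorem InClass.colorable {X V : Type*} {G : SimpleGraph X} {H : SimpleGraph V} {h : ℕ}
    (hh : 0 < h) (hG : InClass h G) {K : Set X} (hK : G.IsClique K) (r : V → X)
    (hc : ∀ u w, H.Adj u w → ∃ x ∈ K, G.Adj (r u) x ∧ G.Adj (r w) x)
    (hd : ∀ u w, H.Adj u w → ∃ x ∈ K, G.Adj (r w) x ∧ ¬ G.Adj (r u) x ∧ r u ≠ x) :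
    H.Colorable h := by
  classical
  obtain ⟨m, T, P, hP, hdeg⟩ := hG
  have hT := hP.isTree
  have conv : ∀ x, T.IsBtwConvex (P x) := fun x => (hP.isSubpath x).isBtwConvex
  obtain ⟨q, hq⟩ := hP.exists_mem_of_isClique hK
  have hr : ∀ w, ∃ z, z ∈ P (r w) ∧ ∀ x ∈ K, G.Adj (r w) x → z ∈ P x := by
    intro w
    obtain ⟨z, hz⟩ := hP.exists_mem_of_isClique (K := insert (r w) {x ∈ K | G.Adj (r w) x}) (by
      rw [isClique_insert]
      exact ⟨hK.subset fun x hx => hx.1, fun x hx _ => hx.2⟩)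
    exact ⟨z, hz _ (by simp), fun x hx hx' => hz x (by simp [hx, hx'])⟩
  choose z hz hzK using hr
  -- y is the first step from q towards z w, naming the branch of z w.
  have hy : ∀ w, ∃ y, z w ≠ q → T.Adj q y ∧ ∃ p : T.Walk y (z w), q ∉ p.support := by
    intro w
    by_cases hw : z w = q
    · exact ⟨q, fun h => absurd hw h⟩
    obtain ⟨p, hp, -⟩ := hT.existsUnique_path q (z w)
    cases p with
    | nil => exact absurd rfl hw
    | cons hadj p => exact ⟨_, fun _ => ⟨hadj, p, ((Walk.cons_isPath_iff _ _).1 hp).2⟩⟩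
  choose y hy using hy
  obtain ⟨f, hf⟩ := exists_injOn_neighborSet T q hh hdeg
  -- A path of K adjacent to w but not to u contains q and z w; by convexity it would contain z u
  -- and meet the path of u.
  have hsep : ∀ u w, H.Adj u w → z u ∉ {t | T.Btw q t (z w)} := by
    intro u w huw hb
    obtain ⟨x, hxK, hxw, hxu, hne⟩ := hd u w huw
    have : z u ∈ P x := conv x (hq x hxK) (hzK w x hxK hxw) hb
    exact hxu ((hP.adj_iff _ _ hne).2 ⟨z u, hz u, this⟩)
  have hqne : ∀ u w, H.Adj u w → z u ≠ q := by
    intro u w huw he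
    exact hsep u w huw (by rw [he]; exact fun p => p.start_mem_support)
  refine ⟨Coloring.mk (fun w => f (y w)) fun {u w} huw he => ?_⟩
  obtain ⟨hau, pu, hpu⟩ := hy u (hqne u w huw)
  obtain ⟨haw, pw, hpw⟩ := hy w (hqne w u huw.symm)
  have hyy : y u = y w := hf hau haw he
  obtain ⟨x, hxK, hxu, hxw⟩ := hc u w huw
  obtain ⟨a, b, p, hp, hPx⟩ := hP.isSubpath x
  have mem : ∀ t, t ∈ P x → t ∈ p.support := fun t ht => by rw [hPx] at ht; exact ht
  -- If q separated z u from z w, the walk through the common branch vertex would have to visit q;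
  -- the other two orders contradict `hsep`.
  rcases hT.btw_trichotomy hp (mem _ (hzK u x hxK hxu)) (mem _ (hq x hxK))
    (mem _ (hzK w x hxK hxw)) with h₁ | h₁ | h₁
  · have := h₁ (pu.reverse.append (pw.copy hyy.symm rfl))
    rw [Walk.mem_support_append_iff] at this
    rcases this with h | h
    · exact hpu (by simpa using h)
    · exact hpw (by simpa using h)
  · exact hsep u w huw h₁
  · exact hsep w u huw.symm h₁.symm

theorem IsSubpath.image {W W' : Type*} {T : SimpleGraph W} {T' : SimpleGraph W'} {P : Set W}
    (hP : IsSubpath T P) (e : T ≃g T') : IsSubpath T' (e '' P) := by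
  obtain ⟨a, b, p, hp, rfl⟩ := hP
  refine ⟨e a, e b, p.map e.toHom, hp.map e.injective, ?_⟩
  ext x
  simp [Walk.support_map]

/-- The host tree may have any finite vertex type. -/
theorem InClass.of_representation {V W : Type*} [Fintype W] {h : ℕ} {G : SimpleGraph V}
    {T : SimpleGraph W} {P : V → Set W} (hP : IsVPTRepresentation G T P)
    (hT : ∀ x, (T.neighborSet x).encard ≤ h) : InClass h G := by
  classical
  obtain ⟨T', ⟨e⟩⟩ : ∃ T' : SimpleGraph (Fin (Fintype.card W)), Nonempty (T ≃g T') :=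
    ⟨_, ⟨Iso.map (Fintype.equivFin W) T⟩⟩
  refine ⟨Fintype.card W, T', fun v => e '' P v,
    ⟨e.isTree_iff.1 hP.isTree, fun v => (hP.isSubpath v).image e, fun u v huv => ?_⟩, ?_⟩
  · rw [hP.adj_iff u v huv, ← Set.image_inter e.injective, Set.image_nonempty]
  · refine maxDegree_le_of_forall_degree_le _ _ fun x => ?_
    obtain ⟨x, rfl⟩ := e.surjective x
    have h₁ : T'.neighborSet (e x) = e '' T.neighborSet x := by
      ext y
      obtain ⟨y, rfl⟩ := e.surjective y
      rw [e.injective.mem_set_image, mem_neighborSet, mem_neighborSet, e.map_adj_iff]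
    have h₂ := hT x
    rw [← e.injective.encard_image, ← h₁, ← coe_neighborFinset, Set.encard_coe_eq_coe_finsetCard,
      Nat.cast_le, card_neighborFinset_eq_degree] at h₂
    exact h₂

/-! ### Trees given by a parent function. -/

section ParentGraph

variable {W : Type*} {par : W → W} {d : W → ℕ} {r : W}

/-- The graph in which every vertex is joined to its parent. -/
def parentGraph (par : W → W) : SimpleGraph W :=
  SimpleGraph.fromRel fun x y => par x = y

theorem parentGraph_adj {x y : W} :
    (parentGraph par).Adj x y ↔ x ≠ y ∧ (par x = y ∨ par y = x) :=
  SimpleGraph.fromRel_adj _ _ _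

/-- Follow parents: strictly decreasing depth prevents repetition, and a parent-closed set S keeps
track of where the path runs. -/
theorem exists_path_to_root (hd : ∀ x, x ≠ r → d (par x) < d x) {S : Set W}
    (hS : ∀ x ∈ S, par x ∈ S) (x : W) (hx : x ∈ S) :
    ∃ p : (parentGraph par).Walk x r, p.IsPath ∧ ∀ y ∈ p.support, y ∈ S := by
  suffices H : ∀ n x, d x = n → x ∈ S → ∃ p : (parentGraph par).Walk x r, p.IsPath ∧
      ∀ y ∈ p.support, y ∈ S ∧ d y ≤ n by
    obtain ⟨p, hp, h⟩ := H _ x rfl hx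
    exact ⟨p, hp, fun y hy => (h y hy).1⟩
  intro n
  induction n using Nat.strong_induction_on with
  | _ n ih =>
  rintro x rfl hx
  by_cases hxr : x = r
  · subst hxr
    exact ⟨.nil, .nil, by simp [hx]⟩
  · have hlt := hd x hxr
    obtain ⟨p, hp, h⟩ := ih _ hlt (par x) rfl (hS x hx)
    have hadj : (parentGraph par).Adj x (par x) :=
      parentGraph_adj.2 ⟨fun he => by rw [← he] at hlt; exact lt_irrefl _ hlt, .inl rfl⟩
    refine ⟨.cons hadj p, (Walk.cons_isPath_iff _ _).2 ⟨hp, fun hm => ?_⟩, fun y hy => ?_⟩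
    · exact absurd (h x hm).2 (by omega)
    · rw [Walk.support_cons, List.mem_cons] at hy
      rcases hy with rfl | hy
      · exact ⟨hx, le_rfl⟩
      · exact ⟨(h y hy).1, (h y hy).2.trans hlt.le⟩

/-- The graph is connected through the root, and each edge joins a non-root vertex to its parent, so
there are fewer edges than vertices. -/
theorem isTree_parentGraph [Finite W] (hr : par r = r) (hd : ∀ x, x ≠ r → d (par x) < d x) :
    (parentGraph par).IsTree := by
  classical
  have hconn : (parentGraph par).Connected := by
    have hreach : ∀ x, (parentGraph par).Reachable x r := fun x =>
      (exists_path_to_root hd (S := Set.univ) (by simp) x trivial).choose.reachable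
    have : Nonempty W := ⟨r⟩
    exact ⟨fun x y => (hreach x).trans (hreach y).symm⟩
  rw [isTree_iff_connected_and_card]
  refine ⟨hconn, le_antisymm ?_ hconn.card_vert_le_card_edgeSet_add_one⟩
  have hsub : (parentGraph par).edgeSet ⊆ (fun x => s(x, par x)) '' ({r}ᶜ : Set W) := by
    intro e
    induction e using Sym2.ind with
    | _ x y =>
    intro he
    rw [mem_edgeSet, parentGraph_adj] at he
    obtain ⟨hne, rfl | rfl⟩ := he
    · exact ⟨x, fun hx => hne (by rw [Set.mem_singleton_iff.1 hx, hr]), rfl⟩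
    · exact ⟨y, fun hy => hne (by rw [Set.mem_singleton_iff.1 hy, hr]), Sym2.eq_swap⟩
  have h₁ : (parentGraph par).edgeSet.ncard ≤ ({r}ᶜ : Set W).ncard :=
    (Set.ncard_le_ncard hsub (Set.toFinite _)).trans (Set.ncard_image_le (Set.toFinite _))
  have h₂ := Set.ncard_add_ncard_compl ({r} : Set W)
  rw [Set.ncard_singleton] at h₂
  rw [Nat.card_coe_set_eq]
  omega

end ParentGraph

/-! ### The host tree built from a coloring. -/

section Caterpillars

variable {h n : ℕ}

/-- The vertices of a tree with `h` caterpillars attached to a root: the root, the spine vertices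
of each caterpillar, and `n` leaves. -/
abbrev CaterpillarVertex (h n : ℕ) : Type := Option ((Fin h × Fin n) ⊕ Fin n)

/-- The leaf `i` hangs at height `i` from the spine numbered `c i`. -/
def caterpillarParent (c : Fin n → Fin h) : CaterpillarVertex h n → CaterpillarVertex h n
  | none => none
  | some (.inl (_, ⟨0, _⟩)) => none
  | some (.inl (k, ⟨j + 1, hj⟩)) => some (.inl (k, ⟨j, by omega⟩))
  | some (.inr i) => some (.inl (c i, i))

/-- The distance to the root. -/
def caterpillarDepth : CaterpillarVertex h n → ℕ
  | none => 0
  | some (.inl (_, j)) => j + 1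
  | some (.inr i) => i + 2

theorem caterpillarDepth_parent_lt (c : Fin n → Fin h) (x : CaterpillarVertex h n)
    (hx : x ≠ none) : caterpillarDepth (caterpillarParent c x) < caterpillarDepth x := by
  rcases x with _ | ⟨k, ⟨_ | j, hj⟩⟩ | i
  · exact absurd rfl hx
  all_goals simp [caterpillarParent, caterpillarDepth]

theorem isTree_caterpillar (c : Fin n → Fin h) : (parentGraph (caterpillarParent c)).IsTree :=
  isTree_parentGraph (d := caterpillarDepth) (r := none) rfl (caterpillarDepth_parent_lt c)

/-- The root has at most one neighbour per color, while a spine vertex has at most three: parent,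
successor and leaf. -/
theorem encard_neighborSet_caterpillar_le (c : Fin n → Fin h) (hh : 3 ≤ h)
    (x : CaterpillarVertex h n) :
    ((parentGraph (caterpillarParent c)).neighborSet x).encard ≤ h := by
  rcases x with _ | ⟨k, j⟩ | i
  · rcases n with _ | n
    · rw [Set.encard_eq_zero.2]
      · simp
      · ext y
        rcases y with _ | ⟨k, j⟩ | i
        · simp
        · exact j.elim0
        · exact i.elim0
    · have hsub : (parentGraph (caterpillarParent c)).neighborSet none ⊆
          Set.range fun k : Fin h => (some (.inl (k, 0)) : CaterpillarVertex h (n + 1)) := by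
        intro y hy
        rw [mem_neighborSet, parentGraph_adj] at hy
        rcases y with _ | ⟨k, ⟨_ | j, hj⟩⟩ | i
        · exact absurd rfl hy.1
        · exact ⟨k, rfl⟩
        all_goals simp [caterpillarParent] at hy
      refine (Set.encard_le_encard hsub).trans ?_
      rw [← Set.image_univ]
      refine (Set.encard_image_le _ _).trans ?_
      simp
  -- The last spine vertex has no successor; `none` is a dummy there.
  · have hsub : (parentGraph (caterpillarParent c)).neighborSet (some (.inl (k, j))) ⊆
        {caterpillarParent c (some (.inl (k, j))),
          (if hj : j.1 + 1 < n then some (.inl (k, ⟨j + 1, hj⟩)) else none), some (.inr j)} := by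
      intro y hy
      rw [mem_neighborSet, parentGraph_adj] at hy
      rcases hy with ⟨hne, rfl | hy⟩
      · simp
      rcases y with _ | ⟨k', ⟨_ | j', hj'⟩⟩ | i
      · simp [caterpillarParent] at hy
      · simp [caterpillarParent] at hy
      · simp only [caterpillarParent, Option.some.injEq, Sum.inl.injEq, Prod.mk.injEq] at hy
        obtain ⟨rfl, rfl⟩ := hy
        simp [hj']
      · simp only [caterpillarParent, Option.some.injEq, Sum.inl.injEq, Prod.mk.injEq] at hy
        obtain ⟨rfl, rfl⟩ := hy
        simp
    refine (Set.encard_le_encard hsub).trans (le_trans ?_ (Nat.cast_le.2 hh))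
    refine (Set.encard_insert_le _ _).trans
      ((add_le_add_left (Set.encard_insert_le _ _) 1).trans ?_)
    rw [Set.encard_singleton]
    norm_num
  · have hsub : (parentGraph (caterpillarParent c)).neighborSet (some (.inr i)) ⊆
        {some (.inl (c i, i))} := by
      intro y hy
      rw [mem_neighborSet, parentGraph_adj] at hy
      rcases hy with ⟨hne, rfl | hy⟩
      · simp [caterpillarParent]
      rcases y with _ | ⟨k', ⟨_ | j', hj'⟩⟩ | i <;> simp [caterpillarParent] at hy
    refine (Set.encard_le_encard hsub).trans ?_
    rw [Set.encard_singleton]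
    exact_mod_cast (by omega : 1 ≤ h)

/-- The leaf `i`, or the root. -/
def caterpillarTip (h : ℕ) : Option (Fin n) → CaterpillarVertex h n
  | none => none
  | some i => some (.inr i)

/-- The arm stays in its own spine, so arms of different colors meet only at the root. -/
theorem exists_arm (c : Fin n → Fin h) (a : Option (Fin n)) :
    ∃ p : (parentGraph (caterpillarParent c)).Walk (caterpillarTip h a) none, p.IsPath ∧
      ∀ y ∈ p.support, y = none ∨ ∃ i, a = some i ∧
        (y = some (.inr i) ∨ ∃ j, y = some (.inl (c i, j))) := by
  refine exists_path_to_root (caterpillarDepth_parent_lt c)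
    (S := {y | y = none ∨ ∃ i, a = some i ∧
      (y = some (.inr i) ∨ ∃ j, y = some (.inl (c i, j)))}) ?_ _ ?_
  · rintro y (rfl | ⟨i, rfl, rfl | ⟨⟨_ | j, hj⟩, rfl⟩⟩)
    · exact .inl rfl
    · exact .inr ⟨i, rfl, .inr ⟨i, rfl⟩⟩
    · exact .inl rfl
    · exact .inr ⟨i, rfl, .inr ⟨_, rfl⟩⟩
  · rcases a with _ | i
    · exact .inl rfl
    · exact .inr ⟨i, rfl, .inl rfl⟩

/-- Two leaves of different caterpillars (or the root) are joined by a path through the root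
which meets no other leaf. -/
theorem exists_isSubpath_of_tips (c : Fin n → Fin h) (a b : Option (Fin n))
    (hab : ∀ i ∈ a, ∀ j ∈ b, c i ≠ c j) :
    ∃ P, IsSubpath (parentGraph (caterpillarParent c)) P ∧ none ∈ P ∧
      ∀ i, some (.inr i) ∈ P ↔ i ∈ a ∨ i ∈ b := by
  obtain ⟨p, hp, hpS⟩ := exists_arm c a
  obtain ⟨q, hq, hqS⟩ := exists_arm c b
  refine ⟨_, ⟨_, _, p.append q.reverse, hp.append_of_disjoint hq.reverse ?_, rfl⟩, ?_, ?_⟩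
  · intro x hx hx'
    rw [Walk.support_reverse, List.mem_reverse] at hx'
    rcases hpS x hx with h₁ | ⟨i, rfl, hi⟩
    · exact h₁
    rcases hqS x hx' with h₁ | ⟨j, rfl, hj⟩
    · exact h₁
    have hij := hab i rfl j rfl
    rcases hi with rfl | ⟨i', rfl⟩ <;> rcases hj with hj | ⟨j', hj⟩ <;>
      simp only [Option.some.injEq, Sum.inr.injEq, Sum.inl.injEq, Prod.mk.injEq, reduceCtorEq]
        at hj
    · exact absurd (congrArg c hj) hij
    · exact absurd hj.1 hij
  · simp
  · intro i
    simp only [Set.mem_ofPred_eq, Walk.mem_support_append_iff, Walk.support_reverse,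
      List.mem_reverse]
    refine or_congr ⟨fun hi => ?_, fun hi => ?_⟩ ⟨fun hi => ?_, fun hi => ?_⟩
    · rcases hpS _ hi with h₁ | ⟨j, rfl, h₁ | ⟨j', h₁⟩⟩ <;> simp_all
    · obtain rfl : a = some i := hi
      exact p.start_mem_support
    · rcases hqS _ hi with h₁ | ⟨j, rfl, h₁ | ⟨j', h₁⟩⟩ <;> simp_all
    · obtain rfl : b = some i := hi
      exact q.start_mem_support

end Caterpillars

/-- A graph consisting of a clique and of an independent set indexed by `h`-colored legs is in
`[h,2,1]` as soon as every vertex of the clique is adjacent to at most two legs, of different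
colors. -/
theorem InClass.of_legs {X V : Type*} [Fintype V] {G : SimpleGraph X} {h : ℕ} (hh : 3 ≤ h)
    (c : V → Fin h) (leg : X → Option V)
    (hclique : ∀ x y, x ≠ y → leg x = none → leg y = none → G.Adj x y)
    (hindep : ∀ x y v w, x ≠ y → leg x = some v → leg y = some w → v ≠ w ∧ ¬ G.Adj x y)
    (hends : ∀ y, leg y = none → ∃ a b : Option V, (∀ v ∈ a, ∀ w ∈ b, c v ≠ c w) ∧
      ∀ x v, leg x = some v → (G.Adj x y ↔ v ∈ a ∨ v ∈ b)) :
    InClass h G := by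
  let ε := Fintype.equivFin V
  -- A leg is a single leaf; a clique vertex is a path through the root ending at the leaves of its
  -- legs.
  have hP : ∀ x, ∃ P, IsSubpath (parentGraph (caterpillarParent (c ∘ ε.symm))) P ∧
      (∀ v, leg x = some v → P = {some (.inr (ε v))}) ∧
      (leg x = none → none ∈ P ∧ ∀ y v, leg y = some v → (G.Adj y x ↔ some (.inr (ε v)) ∈ P)) := by
    intro x
    rcases hx : leg x with _ | v
    · obtain ⟨a, b, hab, hadj⟩ := hends x hx
      obtain ⟨P, hP, h₀, hPi⟩ := exists_isSubpath_of_tips (c ∘ ε.symm) (a.map ε) (b.map ε) (by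
        intro i hi j hj
        obtain ⟨v, hv, rfl⟩ := Option.mem_map.1 hi
        obtain ⟨w, hw, rfl⟩ := Option.mem_map.1 hj
        simpa using hab v hv w hw)
      refine ⟨P, hP, by simp, fun _ => ⟨h₀, fun y v hy => ?_⟩⟩
      rw [hPi, hadj y v hy, Option.mem_map_of_injective ε.injective,
        Option.mem_map_of_injective ε.injective]
    · refine ⟨{some (.inr (ε v))}, ⟨_, _, (.nil : Walk _ (some (.inr (ε v))) _), .nil, by
        ext; simp⟩, fun w hw => ?_, by simp⟩
      rw [Option.some.inj hw]
  choose P hP hleg hnone using hP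
  refine InClass.of_representation (P := P) ⟨isTree_caterpillar _, hP, fun x y hxy => ?_⟩
    (encard_neighborSet_caterpillar_le _ hh)
  rcases hx : leg x with _ | v <;> rcases hy : leg y with _ | w
  · exact iff_of_true (hclique x y hxy hx hy) ⟨none, (hnone x hx).1, (hnone y hy).1⟩
  · rw [G.adj_comm, (hnone x hx).2 y w hy, hleg y w hy, Set.inter_singleton_nonempty]
  · rw [(hnone y hy).2 x v hx, hleg x v hx, Set.singleton_inter_nonempty]
  · obtain ⟨hvw, hadj⟩ := hindep x y v w hxy hx hy
    refine iff_of_false hadj ?_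
    rw [hleg x v hx, hleg y w hy, Set.singleton_inter_nonempty]
    simpa using hvw

/-! ### Colorability of H and membership of G_H and its vertex-deleted subgraphs. -/

section GH

variable {V : Type*} [Fintype V] {H : SimpleGraph V}

theorem vert_notMem_centralClique (v : V) : GHVertex.vert v ∉ centralClique H := by
  simp [centralClique]

theorem vert_mem_vertexClique {v w : V} : GHVertex.vert v ∈ vertexClique H w ↔ v = w := by
  simp [vertexClique]

theorem edge_mem_vertexClique {e : Sym2 V} {he : e ∈ H.edgeSet} {w : V} :
    GHVertex.edge e he ∈ vertexClique H w ↔ w ∈ e := by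
  simp only [vertexClique, Set.mem_ofPred_eq, reduceCtorEq, exists_false, or_false, false_or,
    GHVertex.edge.injEq]
  exact ⟨fun ⟨_, _, h₁, h₂⟩ => h₂ ▸ h₁, fun h₁ => ⟨e, he, h₁, rfl⟩⟩

open scoped Classical in
theorem pend_mem_vertexClique {v : V} {hv : H.degree v = 1} {w : V} :
    GHVertex.pend v hv ∈ vertexClique H w ↔ v = w := by
  simp only [vertexClique, Set.mem_ofPred_eq, reduceCtorEq, exists_false, and_false, false_or,
    GHVertex.pend.injEq]
  exact ⟨fun ⟨_, h⟩ => h, fun h => ⟨h ▸ hv, h⟩⟩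

theorem edge_mem_centralClique {e : Sym2 V} {he : e ∈ H.edgeSet} :
    GHVertex.edge e he ∈ centralClique H := .inl ⟨e, he, rfl⟩

open scoped Classical in
theorem pend_mem_centralClique {v : V} {hv : H.degree v = 1} :
    GHVertex.pend v hv ∈ centralClique H := .inr ⟨v, hv, rfl⟩

theorem isClique_centralClique : (graphGH H).IsClique (centralClique H) :=
  fun _ hx _ hy hxy => ⟨hxy, .inl ⟨hx, hy⟩⟩

theorem graphGH_adj_vert {v : V} {y : GHVertex H} :
    (graphGH H).Adj (.vert v) y ↔ .vert v ≠ y ∧ y ∈ vertexClique H v := by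
  refine and_congr_right fun _ => ⟨?_, fun hy => .inr ⟨v, .inl rfl, hy⟩⟩
  rintro (⟨h, -⟩ | ⟨w, hv, hy⟩)
  · exact absurd h (vert_notMem_centralClique v)
  · rwa [vert_mem_vertexClique.1 hv]

theorem graphGH_adj_vert_of_mem {v : V} {y : GHVertex H} (hy : y ∈ centralClique H) :
    (graphGH H).Adj (.vert v) y ↔ y ∈ vertexClique H v := by
  rw [graphGH_adj_vert, and_iff_right]
  rintro rfl
  exact vert_notMem_centralClique v hy

/-- The vertex of `H` underlying a vertex of `G_H` outside of the central clique. -/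
def GHVertex.toVert : GHVertex H → Option V
  | .vert v => some v
  | _ => none

theorem GHVertex.toVert_eq_some {x : GHVertex H} {v : V} : x.toVert = some v ↔ x = .vert v := by
  cases x <;> simp [GHVertex.toVert]

theorem GHVertex.toVert_eq_none {x : GHVertex H} : x.toVert = none ↔ x ∈ centralClique H := by
  rcases x with v | ⟨e, he⟩ | ⟨v, hv⟩
  · simp [GHVertex.toVert, vert_notMem_centralClique]
  · simp [GHVertex.toVert, edge_mem_centralClique]
  · simp [GHVertex.toVert, pend_mem_centralClique]

/-- An induced subgraph of `G_H` is in `[h,2,1]` if `H` has an `h`-coloring which may only fail at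
edges for which `G` lacks an end or the edge vertex. -/
theorem inClass_of_embedding {X : Type*} {G : SimpleGraph X} {h : ℕ} (hh : 3 ≤ h)
    (φ : G ↪g graphGH H) (c : V → Fin h)
    (hc : ∀ u w (huw : s(u, w) ∈ H.edgeSet), .vert u ∈ Set.range φ → .vert w ∈ Set.range φ →
      .edge s(u, w) huw ∈ Set.range φ → c u ≠ c w) : InClass h G := by
  classical
  refine InClass.of_legs hh c (fun x => (φ x).toVert) ?_ ?_ ?_
  · intro x y hxy hx hy
    rw [GHVertex.toVert_eq_none] at hx hy
    exact φ.map_adj_iff.1 (isClique_centralClique hx hy (φ.injective.ne hxy))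
  · intro x y v w hxy hx hy
    rw [GHVertex.toVert_eq_some] at hx hy
    have hvw : v ≠ w := by
      rintro rfl
      exact hxy (φ.injective (hx.trans hy.symm))
    refine ⟨hvw, fun hadj => ?_⟩
    rw [← φ.map_adj_iff, hx, hy, graphGH_adj_vert, vert_mem_vertexClique] at hadj
    exact hvw hadj.2.symm
  · intro y hy
    rw [GHVertex.toVert_eq_none] at hy
    have key : ∀ x v, (φ x).toVert = some v →
        (G.Adj x y ↔ φ y ∈ vertexClique H v) ∧ .vert v ∈ Set.range φ := by
      intro x v hx
      rw [GHVertex.toVert_eq_some] at hx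
      rw [← φ.map_adj_iff, hx, graphGH_adj_vert_of_mem hy]
      exact ⟨Iff.rfl, x, hx⟩
    rcases hy with ⟨e, he, hye⟩ | ⟨v, hv, hyv⟩
    · induction e using Sym2.ind with
      | _ u w =>
      -- An end missing from G imposes nothing, so the path stops at the root on that side.
      refine ⟨if .vert u ∈ Set.range φ then some u else none,
        if .vert w ∈ Set.range φ then some w else none, ?_, fun x v hx => ?_⟩
      · intro u' hu' w' hw'
        simp only [Option.mem_def, Option.ite_none_right_eq_some, Option.some.injEq] at hu' hw'
        obtain ⟨hu, rfl⟩ := hu'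
        obtain ⟨hw, rfl⟩ := hw'
        exact hc _ _ he hu hw ⟨y, hye⟩
      · rw [(key x v hx).1, hye, edge_mem_vertexClique]
        have := (key x v hx).2
        simp only [Option.mem_def, Option.ite_none_right_eq_some, Option.some.injEq, Sym2.mem_iff]
        constructor
        · rintro (rfl | rfl) <;> simp [this]
        · rintro (⟨-, rfl⟩ | ⟨-, rfl⟩) <;> simp
    · refine ⟨some v, none, by simp, fun x w hx => ?_⟩
      rw [(key x w hx).1, hyv, pend_mem_vertexClique]
      simp

/-- If an induced subgraph of `G_H` is in `[h,2,1]`, then a graph on some of its vertices from `H`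
is `h`-colorable, provided that its edges are witnessed by the central clique. -/
theorem colorable_of_embedding {X V' : Type*} {G : SimpleGraph X} {h : ℕ} (hh : 0 < h)
    (φ : G ↪g graphGH H) (hG : InClass h G) {H' : SimpleGraph V'} (ι : V' → V)
    (hι : ∀ v, .vert (ι v) ∈ Set.range φ)
    (hc : ∀ u w, H'.Adj u w → ∃ x ∈ centralClique H, x ∈ Set.range φ ∧
      x ∈ vertexClique H (ι u) ∧ x ∈ vertexClique H (ι w))
    (hd : ∀ u w, H'.Adj u w → ∃ x ∈ centralClique H, x ∈ Set.range φ ∧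
      x ∉ vertexClique H (ι u) ∧ x ∈ vertexClique H (ι w)) : H'.Colorable h := by
  choose r hr using hι
  have hadj : ∀ v x, φ x ∈ centralClique H →
      (G.Adj (r v) x ↔ φ x ∈ vertexClique H (ι v)) := by
    intro v x hx
    rw [← φ.map_adj_iff, hr, graphGH_adj_vert_of_mem hx]
  refine hG.colorable hh (K := φ ⁻¹' centralClique H) (fun x hx y hy hxy =>
    φ.map_adj_iff.1 (isClique_centralClique hx hy (φ.injective.ne hxy))) r ?_ ?_
  · intro u w huw
    obtain ⟨_, hx, ⟨x, rfl⟩, hu, hw⟩ := hc u w huw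
    exact ⟨x, hx, (hadj u x hx).2 hu, (hadj w x hx).2 hw⟩
  · intro u w huw
    obtain ⟨_, hx, ⟨x, rfl⟩, hu, hw⟩ := hd u w huw
    refine ⟨x, hx, (hadj w x hx).2 hw, fun h => hu ((hadj u x hx).1 h), ?_⟩
    rintro rfl
    rw [hr] at hx
    exact vert_notMem_centralClique _ hx

open scoped Classical in
theorem exists_adj_ne_of_degree_ne_one {u w : V} (huw : H.Adj u w) (hw : H.degree w ≠ 1) :
    ∃ x, H.Adj w x ∧ x ≠ u := by
  by_contra! hcon
  refine hw ?_
  rw [← card_neighborFinset_eq_degree, Finset.card_eq_one]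
  refine ⟨u, Finset.eq_singleton_iff_unique_mem.2 ⟨by simpa using huw.symm, fun x hx => ?_⟩⟩
  exact hcon x (by simpa using hx)

/-- This is the purpose of the pendants: a second edge at w distinguishes it from u, and the pendant
does so when there is none. -/
theorem exists_mem_vertexClique_notMem {u w : V} (huw : H.Adj u w) :
    ∃ x ∈ centralClique H, x ∉ vertexClique H u ∧ x ∈ vertexClique H w := by
  classical
  by_cases hw : H.degree w = 1
  · refine ⟨.pend w (by convert hw), pend_mem_centralClique, ?_, ?_⟩
    · rw [pend_mem_vertexClique]
      exact huw.ne'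
    · rw [pend_mem_vertexClique]
  · obtain ⟨x, hx, hxu⟩ := exists_adj_ne_of_degree_ne_one huw (by convert hw)
    refine ⟨.edge s(w, x) (H.mem_edgeSet.2 hx), edge_mem_centralClique, ?_, ?_⟩
    · rw [edge_mem_vertexClique, Sym2.mem_iff]
      rintro (h | h)
      exacts [huw.ne h, hxu h.symm]
    · rw [edge_mem_vertexClique]
      simp

theorem edge_mem_vertexClique_inter {u w : V} (huw : s(u, w) ∈ H.edgeSet) :
    .edge s(u, w) huw ∈ vertexClique H u ∧ .edge s(u, w) huw ∈ vertexClique H w := by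
  simp [edge_mem_vertexClique]

theorem inClass_graphGH_iff {h : ℕ} (hh : 3 ≤ h) : InClass h (graphGH H) ↔ H.Colorable h := by
  constructor
  · intro hG
    refine colorable_of_embedding (by omega) Embedding.refl hG id (by simp) (fun u w huw => ?_)
      (fun u w huw => ?_)
    · exact ⟨_, edge_mem_centralClique, ⟨_, rfl⟩, edge_mem_vertexClique_inter (H.mem_edgeSet.2 huw)⟩
    · obtain ⟨x, hx, h₁⟩ := exists_mem_vertexClique_notMem huw
      exact ⟨x, hx, ⟨x, rfl⟩, h₁⟩
  · rintro ⟨c⟩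
    exact inClass_of_embedding hh Embedding.refl c fun u w huw _ _ _ => c.valid huw

theorem mem_range_embedding_induce {X : Type*} {G : SimpleGraph X} {s : Set X} {x : X} :
    x ∈ Set.range (Embedding.induce (G := G) s) ↔ x ∈ s := by
  constructor
  · rintro ⟨y, rfl⟩
    exact y.2
  · exact fun hx => ⟨⟨x, hx⟩, rfl⟩

/-- G_H - v keeps the whole central clique, so it need not be G_(H-v); the witnesses of H still
serve for H - v. -/
theorem inClass_deleteVertex_vert_iff {h : ℕ} (hh : 3 ≤ h) (v : V) :
    InClass h (deleteVertex (graphGH H) (.vert v)) ↔ (deleteVertex H v).Colorable h := by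
  classical
  constructor
  · intro hG
    have hK : ∀ x ∈ centralClique H, x ∈ ({.vert v}ᶜ : Set (GHVertex H)) := by
      rintro x hx rfl
      exact vert_notMem_centralClique v hx
    refine colorable_of_embedding (by omega) (Embedding.induce _) hG (fun u => u.1) (fun u => ?_)
      (fun u w huw => ?_) (fun u w huw => ?_)
    · rw [mem_range_embedding_induce]
      exact fun h => u.2 (GHVertex.vert.inj h)
    · exact ⟨_, edge_mem_centralClique, mem_range_embedding_induce.2 (hK _ edge_mem_centralClique),
        edge_mem_vertexClique_inter (H.mem_edgeSet.2 huw)⟩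
    · obtain ⟨x, hx, h₁⟩ := exists_mem_vertexClique_notMem (H := H) huw
      exact ⟨x, hx, mem_range_embedding_induce.2 (hK x hx), h₁⟩
  · rintro ⟨c⟩
    refine inClass_of_embedding hh (Embedding.induce _)
      (fun u => if hu : u = v then ⟨0, by omega⟩ else c ⟨u, hu⟩) fun u w huw hu hw _ => ?_
    rw [mem_range_embedding_induce] at hu hw
    have hu' : u ≠ v := fun h => hu (h ▸ rfl)
    have hw' : w ≠ v := fun h => hw (h ▸ rfl)
    simp only [hu', hw', dite_false]
    exact c.valid huw

/-- The ends of e may share a color, but with x_e gone no path has to join their leaves. -/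
theorem inClass_deleteVertex_edge {h : ℕ} (hh : 3 ≤ h) {e : Sym2 V} (he : e ∈ H.edgeSet)
    (hc : (H.deleteEdges {e}).Colorable h) :
    InClass h (deleteVertex (graphGH H) (.edge e he)) := by
  obtain ⟨c⟩ := hc
  refine inClass_of_embedding hh (Embedding.induce _) c fun u w huw _ _ hx => ?_
  rw [mem_range_embedding_induce] at hx
  refine c.valid ?_
  rw [deleteEdges_adj]
  refine ⟨huw, fun h => hx ?_⟩
  cases h
  rfl

-- Degree 3 leaves an edge at w other than uw and e to distinguish w from u.
open scoped Classical in
theorem colorable_deleteEdges {h : ℕ} (hh : 0 < h) {e : Sym2 V} (he : e ∈ H.edgeSet)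
    (hdeg : ∀ w, 3 ≤ H.degree w) (hG : InClass h (deleteVertex (graphGH H) (.edge e he))) :
    (H.deleteEdges {e}).Colorable h := by
  have hmem : ∀ u w (huw : s(u, w) ∈ H.edgeSet), s(u, w) ≠ e → (.edge s(u, w) huw : GHVertex H) ∈
      Set.range (Embedding.induce (G := graphGH H) {.edge e he}ᶜ) := by
    intro u w huw hne
    rw [mem_range_embedding_induce]
    exact fun h => hne (GHVertex.edge.inj h)
  refine colorable_of_embedding hh (Embedding.induce _) hG id (fun u => ?_) (fun u w huw => ?_)
    (fun u w huw => ?_)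
  · rw [mem_range_embedding_induce]
    simp
  · rw [deleteEdges_adj] at huw
    exact ⟨_, edge_mem_centralClique, hmem u w huw.1 huw.2, edge_mem_vertexClique_inter (H.mem_edgeSet.2 huw.1)⟩
  · rw [deleteEdges_adj] at huw
    -- b is the other end of e when w lies on e, and a dummy otherwise.
    obtain ⟨b, hb⟩ : ∃ b, ∀ x, s(w, x) = e → x = b := by
      by_cases hw : w ∈ e
      · obtain ⟨b, rfl⟩ := hw
        exact ⟨b, fun x hx => Sym2.congr_right.1 hx⟩
      · exact ⟨w, fun x hx => absurd (hx ▸ Sym2.mem_mk_left w x) hw⟩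
    obtain ⟨x, hx, hx'⟩ := Finset.exists_mem_notMem_of_card_lt_card
      (s := {u, b}) (t := H.neighborFinset w)
      (Finset.card_le_two.trans_lt (by rw [card_neighborFinset_eq_degree]; exact hdeg w))
    rw [mem_neighborFinset] at hx
    simp only [Finset.mem_insert, Finset.mem_singleton, not_or] at hx'
    refine ⟨.edge s(w, x) (H.mem_edgeSet.2 hx), edge_mem_centralClique, hmem w x hx fun h => hx'.2 (hb x h), ?_, ?_⟩
    · rw [edge_mem_vertexClique, Sym2.mem_iff]
      rintro (h | h)
      exacts [huw.1.ne h, hx'.1 h.symm]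
    · rw [edge_mem_vertexClique]
      exact Sym2.mem_mk_left w x

end GH

/-! ### Criticality in terms of h-colorability. -/

section Critical

variable {V : Type*} {H : SimpleGraph V} {h : ℕ}

theorem colorable_succ_of_deleteVertex {v : V} (hv : (deleteVertex H v).Colorable h) :
    H.Colorable (h + 1) := by
  classical
  obtain ⟨c⟩ := hv
  let c' : H.Coloring (Option (Fin h)) :=
    Coloring.mk (fun u => if hu : u = v then none else some (c ⟨u, hu⟩)) fun {u w} huw => by
      by_cases hu : u = v <;> by_cases hw : w = v
      · exact absurd (hu.trans hw.symm) huw.ne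
      · simp [hu, hw]
      · simp [hu, hw]
      · simpa [hu, hw] using c.valid (v := ⟨u, hu⟩) (w := ⟨w, hw⟩) huw
  simpa using c'.colorable

/-- A coloring of `H - v` extends to `H` if `v` has fewer neighbours than there are colors. -/
theorem le_degree_of_not_colorable {v : V} [Fintype (H.neighborSet v)] (hH : ¬ H.Colorable h)
    (hv : (deleteVertex H v).Colorable h) : h ≤ H.degree v := by
  classical
  by_contra! hlt
  obtain ⟨c⟩ := hv
  have hpos : 0 < h := by omega
  let f : V → Fin h := fun u => if hu : u = v then ⟨0, hpos⟩ else c ⟨u, hu⟩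
  obtain ⟨k, -, hk⟩ := Finset.exists_mem_notMem_of_card_lt_card
    (s := (H.neighborFinset v).image f) (t := Finset.univ) (by
      refine Finset.card_image_le.trans_lt ?_
      simpa using hlt)
  have hk' : ∀ u, H.Adj v u → f u ≠ k := fun u hu he =>
    hk (Finset.mem_image.2 ⟨u, by simpa using hu, he⟩)
  refine hH ⟨Coloring.mk (fun u => if u = v then k else f u) fun {u w} huw => ?_⟩
  by_cases hu : u = v <;> by_cases hw : w = v
  · exact absurd (hu.trans hw.symm) huw.ne
  · subst hu
    simpa [hw] using (hk' w huw).symm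
  · subst hw
    simpa [hu] using hk' u huw.symm
  · simpa [hu, hw, f] using c.valid (v := ⟨u, hu⟩) (w := ⟨w, hw⟩) huw

theorem chromaticNumber_lt_succ_iff_colorable :
    H.chromaticNumber < ((h + 1 : ℕ) : ℕ∞) ↔ H.Colorable h := by
  rw [← chromaticNumber_le_iff_colorable, Nat.cast_add, Nat.cast_one]
  exact ENat.lt_add_one_iff (ENat.natCast_ne_top h)

theorem isCritical_succ_iff : IsCritical (h + 1) H ↔ ¬ H.Colorable h ∧
    (∀ v, (deleteVertex H v).Colorable h) ∧
      ∀ e ∈ H.edgeSet, (H.deleteEdges {e}).Colorable h := by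
  constructor
  · rintro ⟨⟨hχ, hv⟩, -, he⟩
    rw [hχ] at hv he
    refine ⟨fun hc => ?_, fun v => chromaticNumber_lt_succ_iff_colorable.1 (hv v), fun e hee => chromaticNumber_lt_succ_iff_colorable.1 (he e hee)⟩
    have := chromaticNumber_lt_succ_iff_colorable.2 hc
    rw [hχ] at this
    exact lt_irrefl _ this
  · rintro ⟨hH, hv, he⟩
    -- Some vertex is needed, to be given a fresh color that bounds the chromatic number by h + 1.
    have hne : Nonempty V := by
      by_contra hV
      rw [not_nonempty_iff] at hV
      exact hH (⟨Coloring.mk (fun v => hV.elim v) fun {v} => hV.elim v⟩)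
    have hχ : H.chromaticNumber = ((h + 1 : ℕ) : ℕ∞) :=
      le_antisymm (colorable_succ_of_deleteVertex (hv hne.some)).chromaticNumber_le
        (not_lt.1 fun hc => hH (chromaticNumber_lt_succ_iff_colorable.1 hc))
    refine ⟨⟨hχ, fun v => ?_⟩, hχ, fun e hee => ?_⟩
    · rw [hχ]
      exact chromaticNumber_lt_succ_iff_colorable.2 (hv v)
    · rw [hχ]
      exact chromaticNumber_lt_succ_iff_colorable.2 (he e hee)

end Critical

end PathGraphs

theorem theorem4p1 {V : Type*} [Fintype V] (H : SimpleGraph V) (h : ℕ) (hh : 3 ≤ h) :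
    PathGraphs.IsMinimalNon h (PathGraphs.graphGH H) ↔ PathGraphs.IsCritical (h + 1) H := by
  classical
  open PathGraphs in
  rw [isCritical_succ_iff, IsMinimalNon, inClass_graphGH_iff hh]
  refine and_congr_right fun hH => ⟨fun hmin => ?_, fun ⟨hv, he⟩ x => ?_⟩
  -- The vertex deletions come first: they supply the degree bound needed for the edges.
  · have hv := fun v => (PathGraphs.inClass_deleteVertex_vert_iff hh v).1 (hmin (.vert v))
    exact ⟨hv, fun e he => PathGraphs.colorable_deleteEdges (by omega) he
      (fun w => hh.trans (PathGraphs.le_degree_of_not_colorable hH (hv w))) (hmin (.edge e he))⟩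
  · rcases x with v | ⟨e, hx⟩ | ⟨v, hx⟩
    · exact (PathGraphs.inClass_deleteVertex_vert_iff hh v).2 (hv v)
    · exact PathGraphs.inClass_deleteVertex_edge hh hx (he e hx)
    -- No pendant exists, since degree one contradicts 3 ≤ h ≤ degree.
    · have := PathGraphs.le_degree_of_not_colorable hH (hv v)
      omega
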